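/- Write $\mathbb{T}=\mathbb{R}/\mathbb{Z}$ and $\underline{\mathbb{R}}=\mathbb{R}\cup\{-\infty\}$. A kernel function is a function $K:(-1,0)\cup(0,1)\to\mathbb{R}$ that is concave on $(-1,0)$ and on $(0,1)$ and satisfies $\lim_{t\downarrow 0}K(t)=\lim_{t\uparrow 0}K(t)=:K(0)\in\underline{\mathbb{R}}$. It is singular if $K(0)=-\infty$, strictly concave if it is strictly concave on each of the two intervals, and periodic if $K(t-1)=K(t)$ for $t\in(0,1)$; a periodic kernel extends ($1$-periodically, with value $K(0)$ at the integers) to a function $K:\mathbb{T}\to\underline{\mathbb{R}}$. An $n$-field function is a function $J:\mathbb{T}\to\underline{\mathbb{R}}$ (equivalently, a $1$-periodic function on $\mathbb{R}$) that is bounded above and finite at more than $n$ points of $\mathbb{T}$. Let $L\subset\mathbb{T}^n$ (respectively $\overline{L}$) be the set of all $y=(y_1,\dots,y_n)$ for which there are real representatives $x_j$ of $y_j$ with $x_1<x_2<\dots<x_n<x_1+1$ (respectively $x_1\le x_2\le\dots\le x_n\le x_1+1$). For $y\in\overline{L}$ and $1\le j\le n$, let $I_j(y)$ be the closed positively oriented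 arc of $\mathbb{T}$ from $y_j$ to $y_{j+1}$, where $y_{n+1}:=y_1$; if $y_j=y_{j+1}$ this is the single point $y_j$, except that $I_n(y)=\mathbb{T}$ when $y_1=\dots=y_n$ (in particular when $n=1$). Given $\nu_1,\dots,\nu_n>0$, put $$F(y,t)=J(t)+\sum_{j=1}^n\nu_jK(t-y_j),\qquad m_j(y)=\sup_{t\in I_j(y)}F(y,t),\qquad \underline{m}(y)=\min_{1\le j\le n}m_j(y).$$ Theorem. Let $n\ge 1$ and $\nu_1,\dots,\nu_n>0$, let $K$ be a singular, strictly concave, periodic kernel function, and let $J$ be an arbitrary $n$-field function. Then there exists a maximin point, that is, a point $z\in\overline{L}$ with $\underline{m}(z)=\sup_{y\in\overline{L}}\underline{m}(y)$. Moreover, every maximin point $z$ belongs to $L$ and is an equioscillation point, that is, $m_1(z)=m_2(z)=\dots=m_n(z)$. -/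

import Mathlib

open Set Filter Topology

noncomputable section

namespace SumOfTranslates

/-- A kernel function on `(-1,0) ∪ (0,1)`: concave on both intervals, with equal one-sided limits
(in the extended reals) at `0`. The values of `K : ℝ → ℝ` outside `(-1,0) ∪ (0,1)` are never used. -/
def IsKernel (K : ℝ → ℝ) : Prop :=
  ConcaveOn ℝ (Ioo (-1) 0) K ∧ ConcaveOn ℝ (Ioo 0 1) K ∧
    ∃ l : EReal, Tendsto (fun t => (K t : EReal)) (𝓝[<] 0) (𝓝 l) ∧
      Tendsto (fun t => (K t : EReal)) (𝓝[>] 0) (𝓝 l)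

/-- The extended value `K(0) = lim_{t → 0} K(t)`. -/
def kernelZero (K : ℝ → ℝ) : EReal :=
  limUnder (𝓝[≠] (0 : ℝ)) (fun t => (K t : EReal))

/-- The kernel is singular: `K(0) = -∞`. -/
def IsSingular (K : ℝ → ℝ) : Prop :=
  kernelZero K = ⊥

/-- The kernel is strictly concave on both `(-1,0)` and `(0,1)`. -/
def IsStrictlyConcave (K : ℝ → ℝ) : Prop :=
  StrictConcaveOn ℝ (Ioo (-1) 0) K ∧ StrictConcaveOn ℝ (Ioo 0 1) K

/-- The kernel is `1`-periodic: `K(t - 1) = K(t)`. -/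
def IsPeriodic (K : ℝ → ℝ) : Prop :=
  ∀ t ∈ Ioo (0 : ℝ) 1, K (t - 1) = K t

/-- The length, in `[0,1)`, of the positively oriented arc from `a` to `b` on `ℝ/ℤ`. -/
def arcLength (a b : UnitAddCircle) : ℝ :=
  (AddCircle.equivIco (1 : ℝ) 0 (b - a) : ℝ)

/-- The `1`-periodic extension of a periodic kernel, as an extended real function on `ℝ/ℤ`:
its value at `0` is `K(0)` and its value at the class of `r ∈ (0,1)` is `K(r)`. -/
def periodicExt (K : ℝ → ℝ) (t : UnitAddCircle) : EReal :=
  if t = 0 then kernelZero K else (K (arcLength 0 t) : EReal)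

/-- An (external) `n`-field function on `ℝ/ℤ`: a function with values in `ℝ ∪ {-∞}` that is bounded
above and finite at more than `n` points. -/
def IsField (n : ℕ) (J : UnitAddCircle → EReal) : Prop :=
  (∃ C : ℝ, ∀ t, J t ≤ (C : EReal)) ∧ (n : ℕ∞) < {t | J t ≠ ⊥}.encard

/-- The sum of translates function `F(y,t) = J(t) + ∑ j, ν j * K(t - y j)`. -/
def sumTranslates {n : ℕ} (ν : Fin n → ℝ) (K : ℝ → ℝ) (J : UnitAddCircle → EReal)
    (y : Fin n → UnitAddCircle) (t : UnitAddCircle) : EReal :=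
  J t + ∑ j, (ν j : EReal) * periodicExt K (t - y j)

/-- The open cyclic simplex: `y_1 ≺ y_2 ≺ … ≺ y_n (≺ y_1)`, i.e. the nodes are met in this order,
without coincidences, within one positive turn of the circle. -/
def openSimplex (n : ℕ) : Set (Fin n → UnitAddCircle) :=
  {y | ∃ x : Fin n → ℝ, StrictMono x ∧ (∀ i j, x j < x i + 1) ∧
    ∀ j, y j = (x j : UnitAddCircle)}

/-- The closed cyclic simplex: `y_1 ≼ y_2 ≼ … ≼ y_n (≼ y_1)`, i.e. the nodes are met in this order,
coincidences allowed, within one positive turn of the circle. -/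
def closedSimplex (n : ℕ) : Set (Fin n → UnitAddCircle) :=
  {y | ∃ x : Fin n → ℝ, Monotone x ∧ (∀ i j, x j ≤ x i + 1) ∧
    ∀ j, y j = (x j : UnitAddCircle)}

/-- The closed arc from `y_j` to the cyclically next node, in the positive direction
(`finRotate n` sends `j` to `j + 1` and the last index to the first). If the two nodes coincide, it
is the one-point arc, except that, if all nodes coincide, the last arc is the whole circle
(in particular for `n = 1`), so that the arcs always cover the circle. -/
def arc {n : ℕ} (y : Fin n → UnitAddCircle) (j : Fin n) : Set UnitAddCircle :=
  {t | ((j : ℕ) + 1 = n ∧ ∀ i, y i = y j) ∨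
    arcLength (y j) t ≤ arcLength (y j) (y (finRotate n j))}

/-- The arc maximum `m_j(y)`, the supremum of `F(y,·)` over the `j`-th arc. -/
def arcMax {n : ℕ} (ν : Fin n → ℝ) (K : ℝ → ℝ) (J : UnitAddCircle → EReal)
    (y : Fin n → UnitAddCircle) (j : Fin n) : EReal :=
  sSup (sumTranslates ν K J y '' arc y j)

/-- The minimal arc maximum: the minimum over `j` of `m_j(y)`. -/
def minArcMax {n : ℕ} (ν : Fin n → ℝ) (K : ℝ → ℝ) (J : UnitAddCircle → EReal)
    (y : Fin n → UnitAddCircle) : EReal :=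
  ⨅ j, arcMax ν K J y j

/-- A maximin point: a point of the closed cyclic simplex at which the minimal arc maximum attains
its supremum over the closed cyclic simplex. -/
def IsMaximinPoint {n : ℕ} (ν : Fin n → ℝ) (K : ℝ → ℝ) (J : UnitAddCircle → EReal)
    (z : Fin n → UnitAddCircle) : Prop :=
  z ∈ closedSimplex n ∧ minArcMax ν K J z = ⨆ y ∈ closedSimplex n, minArcMax ν K J y

/-- An equioscillation point: all arc maxima are equal. -/
def Equioscillates {n : ℕ} (ν : Fin n → ℝ) (K : ℝ → ℝ) (J : UnitAddCircle → EReal)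
    (z : Fin n → UnitAddCircle) : Prop :=
  ∀ i j, arcMax ν K J z i = arcMax ν K J z j

end SumOfTranslates

end

noncomputable section

namespace SumOfTranslates

/-! Exponentiate: `exp F` is `exp J` times a product of powers of `expKernel K`. Singularity makes
`expKernel K` continuous with zeros at the integers, so the value `-∞` disappears and `exp F`
vanishes at every node. As `EReal.exp` is an order isomorphism onto `[0,∞]`, arc suprema and their
minimum carry over (`exp_arcMax`, `exp_minArcMax`).

Existence is compactness. Although `J` is arbitrary, each arc supremum is upper semicontinuous in
the nodes (`upperSemicontinuousOn_expArcMax`): `J` is bounded above, the kernel product is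
continuous, and it vanishes at the ends of the arc. Finiteness of `J` at more than `n` points gives
nodes with a positive minimum (`exists_isStrictLift_expArcMax_pos`), while coinciding nodes give
minimum zero, so a maximizer has distinct nodes.

Equioscillation is a perturbation argument (`expArcMax_eq_iInf`). If one arc supremum exceeds the
minimum, move the two ends of that arc towards each other, by distances inversely proportional to
their weights. Seen from a point outside the arc, the two arguments of `K` approach each other with
fixed weighted mean, so strict concavity raises `F` there (`expKernel_rpow_mul_lt`). All other arc
suprema rise strictly, and for a small move the shrunk arc stays above the old minimum,
contradicting maximality. -/

/-! ### The exponentiated kernel -/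

/-- The exponential of the periodic extension of the kernel, as a real function on `ℝ`. It vanishes
at the integers, as it should for a singular kernel. -/
def expKernel (K : ℝ → ℝ) (s : ℝ) : ℝ :=
  if Int.fract s = 0 then 0 else Real.exp (K (Int.fract s))

lemma expKernel_nonneg (K : ℝ → ℝ) (s : ℝ) : 0 ≤ expKernel K s := by
  unfold expKernel
  split_ifs
  · exact le_rfl
  · exact (Real.exp_pos _).le

lemma expKernel_zero (K : ℝ → ℝ) : expKernel K 0 = 0 := by simp [expKernel]

lemma expKernel_add_intCast (K : ℝ → ℝ) (s : ℝ) (m : ℤ) :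
    expKernel K (s + m) = expKernel K s := by
  simp [expKernel]

lemma expKernel_add_one (K : ℝ → ℝ) (s : ℝ) : expKernel K (s + 1) = expKernel K s := by
  simp [expKernel]

lemma expKernel_of_mem (K : ℝ → ℝ) {s : ℝ} (hs : s ∈ Ioo (0 : ℝ) 1) :
    expKernel K s = Real.exp (K s) := by
  have h : Int.fract s = s := Int.fract_eq_self.2 ⟨hs.1.le, hs.2⟩
  simp [expKernel, h, hs.1.ne']

lemma expKernel_of_mem_neg {K : ℝ → ℝ} (hper : IsPeriodic K) {s : ℝ} (hs : s ∈ Ioo (-1 : ℝ) 0) :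
    expKernel K s = Real.exp (K s) := by
  have h : s + 1 ∈ Ioo (0 : ℝ) 1 := ⟨by linarith [hs.1], by linarith [hs.2]⟩
  rw [← expKernel_add_one, expKernel_of_mem K h, ← hper _ h]
  simp

lemma expKernel_pos_of_mem (K : ℝ → ℝ) {s : ℝ} (hs : s ∈ Ioo (0 : ℝ) 1) : 0 < expKernel K s := by
  rw [expKernel_of_mem K hs]
  exact Real.exp_pos _

lemma IsSingular.tendsto_bot {K : ℝ → ℝ} (hK : IsKernel K) (hsing : IsSingular K) :
    Tendsto (fun t => (K t : EReal)) (𝓝[<] 0) (𝓝 ⊥) ∧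
      Tendsto (fun t => (K t : EReal)) (𝓝[>] 0) (𝓝 ⊥) := by
  obtain ⟨-, -, l, hl, hr⟩ := hK
  have h : Tendsto (fun t => (K t : EReal)) (𝓝[≠] 0) (𝓝 l) := by
    rw [← Iio_union_Ioi, nhdsWithin_union]
    exact hl.sup hr
  -- `limUnder` is meaningful here because the punctured limit exists; uniqueness of limits
  -- identifies it with `l`.
  have : l = ⊥ := h.limUnder_eq.symm.trans hsing
  exact this ▸ ⟨hl, hr⟩

lemma tendsto_exp_of_tendsto_bot {K : ℝ → ℝ} {l : Filter ℝ}
    (h : Tendsto (fun t => (K t : EReal)) l (𝓝 ⊥)) :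
    Tendsto (fun t => Real.exp (K t)) l (𝓝 0) := by
  rw [EReal.tendsto_coe_nhds_bot_iff] at h
  exact Real.tendsto_exp_atBot.comp h

/-- Concavity gives continuity inside `(0,1)`, singularity gives the limit `0` at the origin from
both sides, and periodicity transports this to all of `ℝ`. -/
lemma continuous_expKernel {K : ℝ → ℝ} (hK : IsKernel K) (hsing : IsSingular K)
    (hper : IsPeriodic K) : Continuous (expKernel K) := by
  have key : ∀ s ∈ Ico (0 : ℝ) 1, ContinuousAt (expKernel K) s := by
    intro s hs
    rcases hs.1.eq_or_lt with rfl | h0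
    · obtain ⟨hl, hr⟩ := IsSingular.tendsto_bot hK hsing
      rw [continuousAt_iff_punctured_nhds, expKernel_zero, ← Iio_union_Ioi, nhdsWithin_union]
      refine Tendsto.sup ?_ ?_
      · refine (tendsto_exp_of_tendsto_bot hl).congr' ?_
        filter_upwards [Ioo_mem_nhdsLT (show (-1 : ℝ) < 0 by norm_num)] with t ht
        exact (expKernel_of_mem_neg hper ht).symm
      · refine (tendsto_exp_of_tendsto_bot hr).congr' ?_
        filter_upwards [Ioo_mem_nhdsGT (show (0 : ℝ) < 1 by norm_num)] with t ht
        exact (expKernel_of_mem K ht).symm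
    · have hmem : Ioo (0 : ℝ) 1 ∈ 𝓝 s := Ioo_mem_nhds h0 hs.2
      have hc : ContinuousAt (fun t => Real.exp (K t)) s :=
        ((hK.2.1.continuousOn isOpen_Ioo).continuousAt hmem).rexp
      refine hc.congr ?_
      filter_upwards [hmem] with t ht
      exact (expKernel_of_mem K ht).symm
  rw [continuous_iff_continuousAt]
  intro s
  have h1 : expKernel K = fun t => expKernel K (t + ((-⌊s⌋ : ℤ) : ℝ)) :=
    funext fun t => (expKernel_add_intCast K t _).symm
  rw [h1]
  have h2 : s + ((-⌊s⌋ : ℤ) : ℝ) = Int.fract s := by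
    rw [Int.cast_neg, ← sub_eq_add_neg, Int.self_sub_floor]
  have h3 := key _ ⟨Int.fract_nonneg s, Int.fract_lt_one s⟩
  rw [← h2] at h3
  have h4 : ContinuousAt (fun t : ℝ => t + ((-⌊s⌋ : ℤ) : ℝ)) s := by fun_prop
  exact ContinuousAt.comp (f := fun t : ℝ => t + ((-⌊s⌋ : ℤ) : ℝ)) h3 h4

/-- Moving two points of `[0,1]` towards each other, so that their weighted mean is preserved,
increases the weighted product of the values of `expKernel`. -/
lemma expKernel_rpow_mul_lt {K : ℝ → ℝ} (hconc : StrictConcaveOn ℝ (Ioo 0 1) K) {p q h u v : ℝ}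
    (hp : 0 < p) (hq : 0 < q) (hh : 0 < h) (hu : 0 ≤ u) (hv : v ≤ 1)
    (huv : u + h / p < v - h / q) :
    expKernel K u ^ p * expKernel K v ^ q <
      expKernel K (u + h / p) ^ p * expKernel K (v - h / q) ^ q := by
  have hhp : 0 < h / p := div_pos hh hp
  have hhq : 0 < h / q := div_pos hh hq
  have hu' : u + h / p ∈ Ioo (0 : ℝ) 1 := ⟨by linarith, by linarith⟩
  have hv' : v - h / q ∈ Ioo (0 : ℝ) 1 := ⟨by linarith, by linarith⟩
  have hpos : 0 < expKernel K (u + h / p) ^ p * expKernel K (v - h / q) ^ q :=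
    mul_pos (Real.rpow_pos_of_pos (expKernel_pos_of_mem K hu') _)
      (Real.rpow_pos_of_pos (expKernel_pos_of_mem K hv') _)
  -- At `u = 0` or `v = 1` the left side vanishes while the right side is positive; otherwise three
  -- adjacent slopes of `K` are compared.
  rcases hu.eq_or_lt with rfl | hu
  · rwa [expKernel_zero, Real.zero_rpow hp.ne', zero_mul]
  rcases hv.eq_or_lt with rfl | hv
  · have : expKernel K 1 = 0 := by simp [expKernel]
    rwa [this, Real.zero_rpow hq.ne', mul_zero]
  have hum : u ∈ Ioo (0 : ℝ) 1 := ⟨hu, by linarith⟩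
  have hvm : v ∈ Ioo (0 : ℝ) 1 := ⟨by linarith, hv⟩
  rw [expKernel_of_mem K hum, expKernel_of_mem K hvm, expKernel_of_mem K hu',
    expKernel_of_mem K hv', ← Real.exp_mul, ← Real.exp_mul, ← Real.exp_mul, ← Real.exp_mul,
    ← Real.exp_add, ← Real.exp_add, Real.exp_lt_exp]
  have s1 := hconc.slope_anti_adjacent hum hv' (by linarith : u < u + h / p) huv
  have s2 := hconc.slope_anti_adjacent hu' hvm huv (by linarith : v - h / q < v)
  have s3 := s2.trans s1
  rw [sub_sub_cancel, add_sub_cancel_left, div_div_eq_mul_div, div_div_eq_mul_div,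
    div_lt_div_iff_of_pos_right hh] at s3
  linarith

/-! ### Real representatives of nodes and arcs -/

/-- The node following `x j` in the positive direction, among the translates by integers of the
nodes `x`. -/
def nextNode {n : ℕ} (x : Fin n → ℝ) (j : Fin n) : ℝ :=
  x (finRotate n j) + if (j : ℕ) + 1 = n then 1 else 0

/-- Real representatives of a point of the open cyclic simplex. -/
def IsStrictLift {n : ℕ} (x : Fin n → ℝ) : Prop :=
  StrictMono x ∧ ∀ i j, x j < x i + 1

/-- Real representatives of a point of the closed cyclic simplex. -/
def IsLift {n : ℕ} (x : Fin n → ℝ) : Prop :=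
  Monotone x ∧ ∀ i j, x j ≤ x i + 1

lemma IsStrictLift.isLift {n : ℕ} {x : Fin n → ℝ} (hx : IsStrictLift x) : IsLift x :=
  ⟨hx.1.monotone, fun i j => (hx.2 i j).le⟩

lemma val_finRotate {n : ℕ} (j : Fin n) :
    ((finRotate n j : Fin n) : ℕ) = if (j : ℕ) + 1 = n then 0 else (j : ℕ) + 1 := by
  cases n with
  | zero => exact j.elim0
  | succ m => rw [coe_finRotate]; simp [Fin.ext_iff]

lemma IsStrictLift.lt_nextNode {n : ℕ} {x : Fin n → ℝ} (hx : IsStrictLift x) (j : Fin n) :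
    x j < nextNode x j := by
  have h := val_finRotate j
  unfold nextNode
  split_ifs at h ⊢ with hj
  · exact hx.2 _ _
  · rw [add_zero]
    exact hx.1 (Fin.lt_def.2 (by omega))

lemma IsLift.le_nextNode {n : ℕ} {x : Fin n → ℝ} (hx : IsLift x) (j : Fin n) :
    x j ≤ nextNode x j := by
  have h := val_finRotate j
  unfold nextNode
  split_ifs at h ⊢ with hj
  · exact hx.2 _ _
  · rw [add_zero]
    exact hx.1 (Fin.le_def.2 (by omega))

lemma IsLift.nextNode_le_add_one {n : ℕ} {x : Fin n → ℝ} (hx : IsLift x) (i j : Fin n) :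
    nextNode x i ≤ x j + 1 := by
  have h := val_finRotate i
  unfold nextNode
  split_ifs at h ⊢ with hi
  · exact add_le_add_left (hx.1 (Fin.le_def.2 (by omega))) 1
  · rw [add_zero]
    exact hx.2 _ _

lemma IsStrictLift.nextNode_lt_add_one {n : ℕ} (hn : 1 < n) {x : Fin n → ℝ}
    (hx : IsStrictLift x) (j : Fin n) : nextNode x j < x j + 1 := by
  have h := val_finRotate j
  unfold nextNode
  split_ifs at h ⊢ with hj
  · exact add_lt_add_left (hx.1 (Fin.lt_def.2 (by omega))) 1
  · rw [add_zero]
    exact hx.2 _ _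

lemma IsLift.nextNode_le_of_lt {n : ℕ} {x : Fin n → ℝ} (hx : IsLift x) {i j : Fin n}
    (hij : i < j) : nextNode x i ≤ x j := by
  have h := val_finRotate i
  have h1 := Fin.lt_def.1 hij
  have h2 := j.2
  unfold nextNode
  split_ifs at h ⊢ with hi
  · omega
  · rw [add_zero]
    exact hx.1 (Fin.le_def.2 (by omega))

lemma finRotate_ne_self {n : ℕ} (hn : 1 < n) (j : Fin n) : finRotate n j ≠ j := by
  have h := val_finRotate j
  intro h'
  rw [h'] at h
  split_ifs at h <;> omega

/-- The inequality at the last index reads `x (last) < x 0 + 1`, and by monotonicity it bounds all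
the other differences. -/
lemma isStrictLift_of_lt_nextNode {n : ℕ} {x : Fin n → ℝ}
    (h : ∀ j, x j < nextNode x j) : IsStrictLift x := by
  cases n with
  | zero => exact ⟨fun i => i.elim0, fun i => i.elim0⟩
  | succ m =>
    have hmono : StrictMono x := by
      rw [Fin.strictMono_iff_lt_succ]
      intro i
      have h1 := h i.castSucc
      have h2 := i.2
      have h3 : finRotate (m + 1) i.castSucc = i.succ := by
        ext
        rw [val_finRotate]
        simp [h2.ne]
      have h4 : ¬ ((i.castSucc : Fin (m + 1)) : ℕ) + 1 = m + 1 := by simp [h2.ne]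
      rwa [nextNode, if_neg h4, h3, add_zero] at h1
    refine ⟨hmono, fun i j => ?_⟩
    have h1 := h (Fin.last m)
    rw [nextNode, if_pos (by simp), finRotate_last] at h1
    calc x j ≤ x (Fin.last m) := hmono.monotone (Fin.le_last j)
      _ < x 0 + 1 := h1
      _ ≤ x i + 1 := add_le_add_left (hmono.monotone (Fin.zero_le i)) 1

lemma coe_nextNode {n : ℕ} (x : Fin n → ℝ) (j : Fin n) :
    ((nextNode x j : ℝ) : UnitAddCircle) = (x (finRotate n j) : UnitAddCircle) := by
  unfold nextNode
  split_ifs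
  · rw [AddCircle.coe_add, AddCircle.coe_period, add_zero]
  · rw [add_zero]

lemma arcLength_coe (a b : ℝ) :
    arcLength (a : UnitAddCircle) (b : UnitAddCircle) = Int.fract (b - a) := by
  rw [arcLength, ← AddCircle.coe_sub]
  simpa using AddCircle.coe_equivIco_mk_apply (1 : ℝ) (b - a)

lemma arcLength_eq_zero {a b : UnitAddCircle} : arcLength a b = 0 ↔ b = a := by
  induction a using QuotientAddGroup.induction_on with | H a => ?_
  induction b using QuotientAddGroup.induction_on with | H b => ?_
  rw [arcLength_coe, Int.fract_eq_zero_iff, ← sub_eq_zero (a := ((b : ℝ) : UnitAddCircle)),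
    ← AddCircle.coe_sub, AddCircle.coe_eq_zero_iff]
  simp

lemma arcLength_nonneg (a b : UnitAddCircle) : 0 ≤ arcLength a b :=
  (AddCircle.equivIco (1 : ℝ) 0 (b - a)).2.1

lemma coe_add_fract_sub (a s : ℝ) :
    ((a + Int.fract (s - a) : ℝ) : UnitAddCircle) = (s : UnitAddCircle) := by
  rw [← sub_eq_zero, ← AddCircle.coe_sub, AddCircle.coe_eq_zero_iff]
  exact ⟨-⌊s - a⌋, by rw [Int.fract, zsmul_one]; push_cast; ring⟩

/-- The arcs of a point of the open cyclic simplex are the images of the intervals between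
consecutive representatives. -/
lemma arc_coe_eq_image {n : ℕ} {x : Fin n → ℝ} (hx : IsStrictLift x) (j : Fin n) :
    arc (fun i => (x i : UnitAddCircle)) j =
      (fun s : ℝ => (s : UnitAddCircle)) '' Icc (x j) (nextNode x j) := by
  ext t
  induction t using QuotientAddGroup.induction_on with | H s => ?_
  -- `arcLength` takes values below `1`, so it measures the arc correctly only for `n > 1`; for `n =
  -- 1` the arc is a full turn, supplied by the first disjunct of `arc`.
  rcases Nat.lt_or_ge 1 n with hn | hn
  · have h1 := hx.lt_nextNode j
    have h2 := hx.nextNode_lt_add_one hn j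
    have hfr : Int.fract (nextNode x j - x j) = nextNode x j - x j :=
      Int.fract_eq_self.2 ⟨by linarith, by linarith⟩
    have hlen : arcLength (x j : UnitAddCircle) (x (finRotate n j) : UnitAddCircle) =
        nextNode x j - x j := by
      rw [← coe_nextNode, arcLength_coe, hfr]
    have hne : ¬ ∀ i, (x i : UnitAddCircle) = (x j : UnitAddCircle) := by
      intro h
      have := arcLength_eq_zero.2 (h (finRotate n j))
      linarith
    simp only [arc, mem_ofPred_eq, hne, and_false, false_or, hlen, mem_image]
    constructor
    · intro h
      rw [arcLength_coe] at h
      exact ⟨x j + Int.fract (s - x j), ⟨by linarith [Int.fract_nonneg (s - x j)], by linarith⟩,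
        coe_add_fract_sub _ _⟩
    · rintro ⟨s', hs', he⟩
      have : Int.fract (s' - x j) = s' - x j :=
        Int.fract_eq_self.2 ⟨by linarith [hs'.1], by linarith [hs'.2]⟩
      rw [← he, arcLength_coe, this]
      linarith [hs'.2]
  · have hj := j.2
    have hsub : ∀ i, i = j := fun i => Fin.ext (by omega)
    have hnext : nextNode x j = x j + 1 := by
      rw [nextNode, if_pos (by omega), hsub (finRotate n j)]
    refine ⟨fun _ => ⟨x j + Int.fract (s - x j), ⟨?_, ?_⟩, coe_add_fract_sub _ _⟩, fun _ => ?_⟩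
    · linarith [Int.fract_nonneg (s - x j)]
    · rw [hnext]
      linarith [Int.fract_lt_one (s - x j)]
    · exact Or.inl ⟨by omega, fun i => by rw [hsub i]⟩

/-! ### The exponentiated sum of translates -/

/-- The exponential of the sum of translates function, in terms of real representatives. -/
def expSum {n : ℕ} (ν : Fin n → ℝ) (K : ℝ → ℝ) (J : UnitAddCircle → EReal) (x : Fin n → ℝ)
    (s : ℝ) : ℝ :=
  (EReal.exp (J s)).toReal * ∏ j, expKernel K (s - x j) ^ ν j

/-- The supremum of `expSum` between consecutive representatives. -/
def expArcMax {n : ℕ} (ν : Fin n → ℝ) (K : ℝ → ℝ) (J : UnitAddCircle → EReal) (x : Fin n → ℝ)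
    (j : Fin n) : ENNReal :=
  ⨆ s ∈ Icc (x j) (nextNode x j), ENNReal.ofReal (expSum ν K J x s)

lemma expSum_add_one {n : ℕ} (ν : Fin n → ℝ) (K : ℝ → ℝ) (J : UnitAddCircle → EReal)
    (x : Fin n → ℝ) (s : ℝ) : expSum ν K J x (s + 1) = expSum ν K J x s := by
  have h : ((s + 1 : ℝ) : UnitAddCircle) = s := by
    rw [AddCircle.coe_add, AddCircle.coe_period, add_zero]
  simp only [expSum, h, add_sub_right_comm, expKernel_add_one]

lemma expSum_eq_zero {n : ℕ} {ν : Fin n → ℝ} (hν : ∀ j, 0 < ν j) (K : ℝ → ℝ)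
    (J : UnitAddCircle → EReal) (x : Fin n → ℝ) (j : Fin n) : expSum ν K J x (x j) = 0 := by
  rw [expSum, Finset.prod_eq_zero (Finset.mem_univ j), mul_zero]
  rw [sub_self, expKernel_zero, Real.zero_rpow (hν j).ne']

lemma exp_mul_periodicExt {K : ℝ → ℝ} (hsing : IsSingular K) {p : ℝ} (hp : 0 < p) (s : ℝ) :
    EReal.exp ((p : EReal) * periodicExt K (s : UnitAddCircle)) =
      ENNReal.ofReal (expKernel K s ^ p) := by
  have h0 : arcLength 0 (s : UnitAddCircle) = Int.fract s := by
    simpa using arcLength_coe 0 s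
  by_cases h : (s : UnitAddCircle) = 0
  · have h1 : Int.fract s = 0 := by rw [← h0, arcLength_eq_zero, h]
    rw [periodicExt, if_pos h, show kernelZero K = ⊥ from hsing, EReal.coe_mul_bot_of_pos hp,
      expKernel, if_pos h1, Real.zero_rpow hp.ne']
    simp
  · have h1 : Int.fract s ≠ 0 := by rwa [← h0, Ne, arcLength_eq_zero]
    rw [periodicExt, if_neg h, ← EReal.coe_mul, EReal.exp_coe, expKernel, if_neg h1, h0, mul_comm,
      Real.exp_mul]

lemma exp_sum {ι : Type*} (s : Finset ι) (f : ι → EReal) :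
    EReal.exp (∑ i ∈ s, f i) = ∏ i ∈ s, EReal.exp (f i) := by
  classical
  induction s using Finset.induction_on with
  | empty => simp
  | insert a s ha ih => rw [Finset.sum_insert ha, Finset.prod_insert ha, EReal.exp_add, ih]

lemma IsField.exp_le {n : ℕ} {J : UnitAddCircle → EReal} (hJ : IsField n J) :
    ∃ C : ℝ, 0 ≤ C ∧ ∀ t, EReal.exp (J t) ≤ ENNReal.ofReal C := by
  obtain ⟨⟨C, hC⟩, -⟩ := hJ
  refine ⟨Real.exp C, (Real.exp_pos C).le, fun t => ?_⟩
  rw [← EReal.exp_coe]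
  exact EReal.exp_monotone (hC t)

lemma IsField.exp_ne_top {n : ℕ} {J : UnitAddCircle → EReal} (hJ : IsField n J)
    (t : UnitAddCircle) : EReal.exp (J t) ≠ ⊤ := by
  obtain ⟨C, -, hC⟩ := hJ.exp_le
  exact ne_top_of_le_ne_top ENNReal.ofReal_ne_top (hC t)

lemma exp_sumTranslates {n : ℕ} {ν : Fin n → ℝ} (hν : ∀ j, 0 < ν j) {K : ℝ → ℝ}
    (hsing : IsSingular K) {J : UnitAddCircle → EReal} (hJ : IsField n J) (x : Fin n → ℝ) (s : ℝ) :
    EReal.exp (sumTranslates ν K J (fun i => (x i : UnitAddCircle)) (s : UnitAddCircle)) =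
      ENNReal.ofReal (expSum ν K J x s) := by
  rw [sumTranslates, EReal.exp_add, exp_sum, expSum, ENNReal.ofReal_mul ENNReal.toReal_nonneg,
    ENNReal.ofReal_toReal (hJ.exp_ne_top _),
    ENNReal.ofReal_prod_of_nonneg fun j _ => Real.rpow_nonneg (expKernel_nonneg K _) _]
  congr 1
  refine Finset.prod_congr rfl fun j _ => ?_
  rw [← AddCircle.coe_sub, exp_mul_periodicExt hsing (hν j)]

lemma exp_arcMax {n : ℕ} {ν : Fin n → ℝ} (hν : ∀ j, 0 < ν j) {K : ℝ → ℝ}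
    (hsing : IsSingular K) {J : UnitAddCircle → EReal} (hJ : IsField n J) {x : Fin n → ℝ}
    (hx : IsStrictLift x) (j : Fin n) :
    EReal.exp (arcMax ν K J (fun i => (x i : UnitAddCircle)) j) = expArcMax ν K J x j := by
  rw [arcMax, arc_coe_eq_image hx, ← EReal.expOrderIso_apply, image_image, sSup_image,
    OrderIso.map_iSup, expArcMax]
  refine iSup_congr fun s => ?_
  rw [OrderIso.map_iSup]
  refine iSup_congr fun _ => ?_
  rw [EReal.expOrderIso_apply, exp_sumTranslates hν hsing hJ]

lemma exp_minArcMax {n : ℕ} {ν : Fin n → ℝ} (hν : ∀ j, 0 < ν j) {K : ℝ → ℝ}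
    (hsing : IsSingular K) {J : UnitAddCircle → EReal} (hJ : IsField n J) {x : Fin n → ℝ}
    (hx : IsStrictLift x) :
    EReal.exp (minArcMax ν K J (fun i => (x i : UnitAddCircle))) = ⨅ j, expArcMax ν K J x j := by
  rw [minArcMax, ← EReal.expOrderIso_apply, OrderIso.map_iInf]
  exact iInf_congr fun j => exp_arcMax hν hsing hJ hx j

/-- Coinciding nodes make the minimal arc maximum `-∞`. -/
lemma minArcMax_eq_bot {n : ℕ} {ν : Fin n → ℝ} (hν : ∀ j, 0 < ν j) {K : ℝ → ℝ}
    (hsing : IsSingular K) {J : UnitAddCircle → EReal} (hJ : IsField n J) {x : Fin n → ℝ}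
    (hx : IsLift x) (hx' : ¬ IsStrictLift x) :
    minArcMax ν K J (fun i => (x i : UnitAddCircle)) = ⊥ := by
  obtain ⟨j, hj⟩ : ∃ j, nextNode x j ≤ x j := by
    by_contra! h
    exact hx' (isStrictLift_of_lt_nextNode h)
  have hj := hj.antisymm (hx.le_nextNode j)
  have hjn := j.2
  have hn : 1 < n := by
    by_contra! h
    rw [nextNode, if_pos (by omega), show finRotate n j = j from Fin.ext (by omega)] at hj
    linarith
  set y : Fin n → UnitAddCircle := fun i => (x i : UnitAddCircle) with hy
  have hyj : y (finRotate n j) = y j := by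
    rw [hy]
    simp only
    rw [← coe_nextNode, hj]
  -- If all nodes coincide, the last arc is the whole circle, so index `0` is taken instead; it is
  -- not the last one since `n > 1`.
  obtain ⟨i, hi, hi'⟩ : ∃ i, y (finRotate n i) = y i ∧ ¬ ((i : ℕ) + 1 = n ∧ ∀ k, y k = y i) := by
    by_cases hall : ∀ k, y k = y j
    · exact ⟨⟨0, by omega⟩, by rw [hall, hall ⟨0, by omega⟩], fun h => by simp at h; omega⟩
    · exact ⟨j, hyj, fun h => hall h.2⟩
  refine le_bot_iff.1 ((iInf_le _ i).trans (sSup_le ?_))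
  rintro _ ⟨t, ht, rfl⟩
  have ht' : arcLength (y i) t ≤ arcLength (y i) (y (finRotate n i)) := ht.resolve_left hi'
  rw [arcLength_eq_zero.2 hi] at ht'
  rw [arcLength_eq_zero.1 (ht'.antisymm (arcLength_nonneg _ _)), le_bot_iff,
    ← EReal.exp_eq_zero_iff, hy]
  simp only
  rw [exp_sumTranslates hν hsing hJ, expSum_eq_zero hν, ENNReal.ofReal_zero]

/-! ### Semicontinuity and positivity of arc suprema -/

lemma expKernel_pos (K : ℝ → ℝ) {s : ℝ} (h0 : s ≠ 0) (h1 : -1 < s) (h2 : s < 1) :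
    0 < expKernel K s := by
  rcases h0.lt_or_gt with h | h
  · rw [← expKernel_add_one]
    exact expKernel_pos_of_mem K ⟨by linarith, by linarith⟩
  · exact expKernel_pos_of_mem K ⟨h, h2⟩

lemma IsField.toReal_exp_le {n : ℕ} {J : UnitAddCircle → EReal} (hJ : IsField n J) :
    ∃ C : ℝ, 0 ≤ C ∧ ∀ t, (EReal.exp (J t)).toReal ≤ C := by
  obtain ⟨C, hC0, hC⟩ := hJ.exp_le
  exact ⟨C, hC0, fun t => ENNReal.toReal_le_of_le_ofReal hC0 (hC t)⟩

lemma continuous_nextNode {n : ℕ} (j : Fin n) :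
    Continuous fun x : Fin n → ℝ => nextNode x j := by
  unfold nextNode
  fun_prop

/-- Values at nearby node systems are compared at the same point `s`, so `exp (J s)` enters only as
a bounded factor and no regularity of `J` is needed. -/
lemma upperSemicontinuousOn_expArcMax {n : ℕ} {ν : Fin n → ℝ} (hν : ∀ j, 0 < ν j) {K : ℝ → ℝ}
    (hcont : Continuous (expKernel K)) {J : UnitAddCircle → EReal} (hJ : IsField n J)
    (j : Fin n) {a b : ℝ} :
    UpperSemicontinuousOn (fun x => expArcMax ν K J x j)
      {x | IsLift x ∧ a ≤ x j ∧ nextNode x j ≤ b} := by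
  intro x₀ hx₀ c hc
  obtain ⟨r, hr, hrc⟩ := ENNReal.lt_iff_exists_add_pos_lt.1 hc
  obtain ⟨C, hC0, hC⟩ := hJ.toReal_exp_le
  -- Retracting `s` onto the arc leaves the kernel product unchanged on the arc and makes it zero
  -- off it, since the retracted point is then a node. This keeps `g` jointly continuous while the
  -- arc moves.
  set clamp : (Fin n → ℝ) → ℝ → ℝ := fun x s => max (x j) (min s (nextNode x j)) with hclamp
  set g : (Fin n → ℝ) → ℝ → ℝ := fun x s => ∏ i, expKernel K (clamp x s - x i) ^ ν i with hg
  have hgc : Continuous fun p : (Fin n → ℝ) × ℝ => g p.1 p.2 := by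
    have h1 : Continuous fun p : (Fin n → ℝ) × ℝ => clamp p.1 p.2 := by
      have := (continuous_nextNode j).comp (continuous_fst (X := Fin n → ℝ) (Y := ℝ))
      simp only [hclamp]
      exact Continuous.max (by fun_prop) (continuous_snd.min this)
    refine continuous_finsetProd _ fun i _ => ?_
    exact (hcont.comp (h1.sub (by fun_prop))).rpow_const fun _ => Or.inr (hν i).le
  have hclamp_mem : ∀ x s, s ∈ Icc (x j) (nextNode x j) → clamp x s = s := fun x s hs => by
    simp only [hclamp, min_eq_left hs.2, max_eq_right hs.1]
  -- `C` may be `0`, hence the denominator `C + 1`.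
  have hε : 0 < (r : ℝ) / (C + 1) := div_pos (by exact_mod_cast hr) (by linarith)
  have hev : ∀ᶠ x in 𝓝 x₀, ∀ s ∈ Icc a b, g x s < g x₀ s + (r : ℝ) / (C + 1) := by
    refine isCompact_Icc.eventually_forall_of_forall_eventually fun s _ => ?_
    have h2 : Continuous fun p : (Fin n → ℝ) × ℝ => g x₀ p.2 + (r : ℝ) / (C + 1) :=
      (hgc.comp (by fun_prop : Continuous fun p : (Fin n → ℝ) × ℝ => (x₀, p.2))).add
        continuous_const
    exact (hgc.continuousAt.eventually_lt h2.continuousAt (by simpa using hε))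
  filter_upwards [mem_nhdsWithin_of_mem_nhds hev, self_mem_nhdsWithin] with x hx hxX
  refine lt_of_le_of_lt (iSup₂_le fun s hs => ?_) hrc
  have h3 : expSum ν K J x s = (EReal.exp (J s)).toReal * g x s := by
    simp only [expSum, hg, hclamp_mem x s hs]
  have h4 : expSum ν K J x s ≤ (EReal.exp (J s)).toReal * g x₀ s + r := by
    have h5 := hx s ⟨hxX.2.1.trans hs.1, hs.2.trans hxX.2.2⟩
    have h6 : (EReal.exp (J s)).toReal * ((r : ℝ) / (C + 1)) ≤ (C + 1) * ((r : ℝ) / (C + 1)) :=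
      mul_le_mul_of_nonneg_right (by linarith [hC (s : UnitAddCircle)]) hε.le
    rw [mul_div_cancel₀ _ (by linarith : C + 1 ≠ 0)] at h6
    rw [h3]
    have h7 := mul_le_mul_of_nonneg_left h5.le
      (ENNReal.toReal_nonneg (a := EReal.exp (J (s : UnitAddCircle))))
    linarith
  have h8 : ENNReal.ofReal ((EReal.exp (J s)).toReal * g x₀ s) ≤ expArcMax ν K J x₀ j := by
    by_cases hs0 : s ∈ Icc (x₀ j) (nextNode x₀ j)
    · refine le_trans (le_of_eq ?_) (le_iSup₂ (f := fun s (_ : s ∈ Icc (x₀ j) (nextNode x₀ j)) =>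
        ENNReal.ofReal (expSum ν K J x₀ s)) s hs0)
      simp only [expSum, hg, hclamp_mem x₀ s hs0]
    · have hg0 : g x₀ s = 0 := by
        have hle := hx₀.1.le_nextNode j
        rcases lt_or_ge s (x₀ j) with h | h
        · refine Finset.prod_eq_zero (Finset.mem_univ j) ?_
          simp only [hclamp]
          rw [max_eq_left ((min_le_left _ _).trans h.le), sub_self, expKernel_zero,
            Real.zero_rpow (hν j).ne']
        · have h' : nextNode x₀ j ≤ s := by
            by_contra! h'
            exact hs0 ⟨h, h'.le⟩
          refine Finset.prod_eq_zero (Finset.mem_univ (finRotate n j)) ?_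
          simp only [hclamp]
          rw [min_eq_right h', max_eq_right hle, nextNode, add_sub_cancel_left]
          have : expKernel K (if (j : ℕ) + 1 = n then 1 else 0) = 0 := by
            split_ifs <;> simp [expKernel]
          rw [this, Real.zero_rpow (hν _).ne']
      rw [hg0, mul_zero, ENNReal.ofReal_zero]
      exact zero_le
  calc ENNReal.ofReal (expSum ν K J x s)
      ≤ ENNReal.ofReal ((EReal.exp (J s)).toReal * g x₀ s + r) := ENNReal.ofReal_le_ofReal h4
    _ ≤ ENNReal.ofReal ((EReal.exp (J s)).toReal * g x₀ s) + ENNReal.ofReal r :=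
        ENNReal.ofReal_add_le
    _ ≤ expArcMax ν K J x₀ j + r := by
        rw [ENNReal.ofReal_coe_nnreal]
        gcongr

lemma IsField.exists_strictMono {n : ℕ} {J : UnitAddCircle → EReal} (hJ : IsField n J) :
    ∃ t : Fin (n + 1) → ℝ, StrictMono t ∧ (∀ i, t i ∈ Ico (0 : ℝ) 1) ∧
      ∀ i, J (t i : UnitAddCircle) ≠ ⊥ := by
  obtain ⟨D, hD, hcard⟩ := exists_subset_encard_eq (Order.add_one_le_of_lt hJ.2)
  have hfin : D.Finite := finite_of_encard_eq_coe (k := n + 1) (by rw [hcard]; simp)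
  let e : UnitAddCircle → ℝ := fun t => (AddCircle.equivIco (1 : ℝ) 0 t : ℝ)
  have he : Function.Injective e := Subtype.val_injective.comp (Equiv.injective _)
  let S : Finset ℝ := hfin.toFinset.image e
  have hS : S.card = n + 1 := by
    rw [Finset.card_image_of_injective _ he, ← ncard_eq_toFinset_card D hfin, ncard, hcard]
    rfl
  have hmem : ∀ i, S.orderEmbOfFin hS i ∈ S := fun i => Finset.orderEmbOfFin_mem S hS i
  refine ⟨S.orderEmbOfFin hS, (S.orderEmbOfFin hS).strictMono, fun i => ?_, fun i => ?_⟩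
  all_goals
    obtain ⟨t, ht, hti⟩ := Finset.mem_image.1 (hmem i)
    rw [← hti]
  · simpa using (AddCircle.equivIco (1 : ℝ) 0 t).2
  · have : ((e t : ℝ) : UnitAddCircle) = t := (AddCircle.equivIco (1 : ℝ) 0).symm_apply_apply t
    rw [this]
    exact hD (hfin.mem_toFinset.1 ht)

lemma expSum_pos {n : ℕ} {ν : Fin n → ℝ} {K : ℝ → ℝ} {J : UnitAddCircle → EReal}
    (hJ : IsField n J) {x : Fin n → ℝ} {s : ℝ} (hs : J (s : UnitAddCircle) ≠ ⊥)
    (h : ∀ i, 0 < expKernel K (s - x i)) : 0 < expSum ν K J x s :=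
  mul_pos (ENNReal.toReal_pos (by simpa using hs) (hJ.exp_ne_top _))
    (Finset.prod_pos fun i _ => Real.rpow_pos_of_pos (h i) _)

/-- Put the nodes at the midpoints between `n + 1` consecutive points where `J` is finite: arc `j`
then contains `t j.succ`, which is not a node. -/
lemma exists_isStrictLift_expArcMax_pos {n : ℕ} (ν : Fin n → ℝ) (K : ℝ → ℝ)
    {J : UnitAddCircle → EReal} (hJ : IsField n J) :
    ∃ x : Fin n → ℝ, IsStrictLift x ∧ (∀ i, x i ∈ Ico (0 : ℝ) 1) ∧
      ∀ j, 0 < expArcMax ν K J x j := by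
  obtain ⟨t, ht, ht01, htJ⟩ := hJ.exists_strictMono
  let x : Fin n → ℝ := fun i => (t i.castSucc + t i.succ) / 2
  have hlt : ∀ i : Fin n, t i.castSucc < t i.succ := fun i => ht Fin.castSucc_lt_succ
  have h1 : ∀ i, t i.castSucc < x i := fun i => by simp only [x]; linarith [hlt i]
  have h2 : ∀ i, x i < t i.succ := fun i => by simp only [x]; linarith [hlt i]
  have hx01 : ∀ i, x i ∈ Ico (0 : ℝ) 1 := fun i =>
    ⟨(ht01 _).1.trans (h1 i).le, (h2 i).trans (ht01 _).2⟩
  have hx : IsStrictLift x := by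
    refine ⟨fun i j hij => ?_, fun i j => by linarith [(hx01 i).1, (hx01 j).2]⟩
    exact (h2 i).trans_le ((ht.monotone (Fin.succ_le_castSucc_iff.2 hij)).trans (h1 j).le)
  refine ⟨x, hx, hx01, fun j => ?_⟩
  have hmem : t j.succ ∈ Icc (x j) (nextNode x j) := by
    refine ⟨(h2 j).le, ?_⟩
    have hr := val_finRotate j
    unfold nextNode
    split_ifs at hr ⊢ with hj
    · linarith [(hx01 (finRotate n j)).1, (ht01 j.succ).2]
    · have : j.succ = (finRotate n j).castSucc := Fin.ext (by rw [Fin.val_succ, Fin.val_castSucc, hr])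
      rw [add_zero, this]
      exact (h1 _).le
  have hpos : 0 < expSum ν K J x (t j.succ) := by
    refine expSum_pos hJ (htJ _) fun i => expKernel_pos K ?_ ?_ ?_
    · rw [sub_ne_zero]
      rcases le_or_gt i j with h | h
      · exact ((h2 i).trans_le (ht.monotone (Fin.succ_le_succ_iff.2 h))).ne'
      · exact ((ht.monotone (Fin.succ_le_castSucc_iff.2 h)).trans_lt (h1 i)).ne
    · linarith [(hx01 i).2, (ht01 j.succ).1]
    · linarith [(hx01 i).1, (ht01 j.succ).2]
  exact (ENNReal.ofReal_pos.2 hpos).trans_le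
    (le_iSup₂ (f := fun s (_ : s ∈ Icc (x j) (nextNode x j)) =>
      ENNReal.ofReal (expSum ν K J x s)) _ hmem)

/-! ### Shrinking one arc -/

lemma expSum_nextNode {n : ℕ} {ν : Fin n → ℝ} (hν : ∀ j, 0 < ν j) (K : ℝ → ℝ)
    (J : UnitAddCircle → EReal) (x : Fin n → ℝ) (j : Fin n) :
    expSum ν K J x (nextNode x j) = 0 := by
  unfold nextNode
  split_ifs
  · rw [expSum_add_one, expSum_eq_zero hν]
  · rw [add_zero, expSum_eq_zero hν]

lemma expKernel_sub_nextNode {n : ℕ} (K : ℝ → ℝ) (x : Fin n → ℝ) (j : Fin n) (s : ℝ) :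
    expKernel K (s - nextNode x j) = expKernel K (s - x (finRotate n j)) := by
  unfold nextNode
  split_ifs
  · rw [← expKernel_add_one, ← sub_sub, sub_add_cancel]
  · rw [add_zero]

lemma ofReal_expSum_le_expArcMax {n : ℕ} (ν : Fin n → ℝ) (K : ℝ → ℝ) (J : UnitAddCircle → EReal)
    {x : Fin n → ℝ} {j : Fin n} {s : ℝ} (hs : s ∈ Icc (x j) (nextNode x j)) :
    ENNReal.ofReal (expSum ν K J x s) ≤ expArcMax ν K J x j :=
  le_iSup₂ (f := fun s (_ : s ∈ Icc (x j) (nextNode x j)) =>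
    ENNReal.ofReal (expSum ν K J x s)) s hs

lemma expArcMax_ne_top {n : ℕ} {ν : Fin n → ℝ} (hν : ∀ j, 0 < ν j) {K : ℝ → ℝ}
    (hcont : Continuous (expKernel K)) {J : UnitAddCircle → EReal} (hJ : IsField n J)
    (x : Fin n → ℝ) (j : Fin n) : expArcMax ν K J x j ≠ ⊤ := by
  obtain ⟨C, hC0, hC⟩ := hJ.toReal_exp_le
  have hc : Continuous fun s => ∏ i, expKernel K (s - x i) ^ ν i :=
    continuous_finsetProd _ fun i _ =>
      (hcont.comp (by fun_prop)).rpow_const fun _ => Or.inr (hν i).le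
  obtain ⟨B, hB⟩ := (isCompact_Icc (a := x j) (b := nextNode x j)).bddAbove_image hc.continuousOn
  refine ne_top_of_le_ne_top (ENNReal.ofReal_ne_top (r := C * B)) (iSup₂_le fun s hs => ?_)
  refine ENNReal.ofReal_le_ofReal (mul_le_mul (hC _) (hB (mem_image_of_mem _ hs)) ?_ hC0)
  exact Finset.prod_nonneg fun i _ => Real.rpow_nonneg (expKernel_nonneg K _) _

/-- Move the node `j` and the following one towards each other. -/
def shrinkArc {n : ℕ} (ν x : Fin n → ℝ) (j : Fin n) (h : ℝ) : Fin n → ℝ :=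
  Function.update (Function.update x j (x j + h / ν j)) (finRotate n j)
    (x (finRotate n j) - h / ν (finRotate n j))

section shrinkArc

variable {n : ℕ} (ν x : Fin n → ℝ) (j : Fin n) (h : ℝ)

lemma shrinkArc_finRotate : shrinkArc ν x j h (finRotate n j) =
    x (finRotate n j) - h / ν (finRotate n j) := by
  simp [shrinkArc]

lemma shrinkArc_self (hn : 1 < n) : shrinkArc ν x j h j = x j + h / ν j := by
  rw [shrinkArc, Function.update_of_ne (finRotate_ne_self hn j).symm, Function.update_self]

lemma shrinkArc_of_ne {i : Fin n} (h1 : i ≠ j) (h2 : i ≠ finRotate n j) :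
    shrinkArc ν x j h i = x i := by
  rw [shrinkArc, Function.update_of_ne h2, Function.update_of_ne h1]

lemma shrinkArc_zero : shrinkArc ν x j 0 = x := by
  simp [shrinkArc]

lemma continuous_shrinkArc : Continuous (shrinkArc ν x j) := by
  unfold shrinkArc
  exact (continuous_const.update _ (by fun_prop)).update _ (by fun_prop)

lemma nextNode_shrinkArc : nextNode (shrinkArc ν x j h) j =
    nextNode x j - h / ν (finRotate n j) := by
  rw [nextNode, nextNode, shrinkArc_finRotate]
  ring

/-- With `le_nextNode_shrinkArc` this shows that every arc other than `j` is contained in its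
counterpart after the move. -/
lemma shrinkArc_le (hν : ∀ j, 0 < ν j) (hh : 0 ≤ h) {i : Fin n} (hi : i ≠ j) :
    shrinkArc ν x j h i ≤ x i := by
  by_cases h2 : i = finRotate n j
  · rw [h2, shrinkArc_finRotate]
    linarith [div_nonneg hh (hν (finRotate n j)).le]
  · rw [shrinkArc_of_ne ν x j h hi h2]

lemma le_nextNode_shrinkArc (hn : 1 < n) (hν : ∀ j, 0 < ν j) (hh : 0 ≤ h) {i : Fin n}
    (hi : i ≠ j) : nextNode x i ≤ nextNode (shrinkArc ν x j h) i := by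
  refine add_le_add_left ?_ _
  have h2 : finRotate n i ≠ finRotate n j := (finRotate n).injective.ne hi
  by_cases h1 : finRotate n i = j
  · rw [h1, shrinkArc_self ν x j h hn]
    linarith [div_nonneg hh (hν j).le]
  · rw [shrinkArc_of_ne ν x j h h1 h2]

end shrinkArc

lemma eventually_isStrictLift_shrinkArc {n : ℕ} (ν : Fin n → ℝ) {x : Fin n → ℝ}
    (hx : IsStrictLift x) (j : Fin n) : ∀ᶠ h in 𝓝 0, IsStrictLift (shrinkArc ν x j h) := by
  have hc := continuous_shrinkArc ν x j
  have : ∀ᶠ h in 𝓝 0, ∀ i, shrinkArc ν x j h i < nextNode (shrinkArc ν x j h) i := by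
    rw [eventually_all]
    intro i
    refine ContinuousAt.eventually_lt ((continuous_apply i).comp hc).continuousAt
      ((continuous_nextNode i).comp hc).continuousAt ?_
    simp only [shrinkArc_zero]
    exact hx.lt_nextNode i
  exact this.mono fun h hh => isStrictLift_of_lt_nextNode hh

/-- Shrinking one arc increases the sum of translates function, by a definite amount, everywhere
outside that arc. -/
lemma exists_expSum_le_mul_expSum_shrinkArc {n : ℕ} (hn : 1 < n) {ν : Fin n → ℝ}
    (hν : ∀ j, 0 < ν j) {K : ℝ → ℝ} (hcont : Continuous (expKernel K))
    (hconc : StrictConcaveOn ℝ (Ioo 0 1) K) (J : UnitAddCircle → EReal) {x : Fin n → ℝ}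
    (hx : IsStrictLift x) {j : Fin n} {h : ℝ} (hh : 0 < h)
    (hx' : IsStrictLift (shrinkArc ν x j h)) :
    ∃ ρ : ℝ, 0 ≤ ρ ∧ ρ < 1 ∧ ∀ s ∈ Icc (nextNode x j) (x j + 1),
      expSum ν K J x s ≤ ρ * expSum ν K J (shrinkArc ν x j h) s := by
  set x' := shrinkArc ν x j h with hx'def
  set k := finRotate n j with hk
  have hkj : k ≠ j := finRotate_ne_self hn j
  let P : (Fin n → ℝ) → ℝ → ℝ := fun w s => expKernel K (s - w k) ^ ν k * expKernel K (s - w j) ^ ν j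
  have hPc : ∀ w, Continuous (P w) := fun w =>
    ((hcont.comp (by fun_prop)).rpow_const fun _ => Or.inr (hν k).le).mul
      ((hcont.comp (by fun_prop)).rpow_const fun _ => Or.inr (hν j).le)
  have hP0 : ∀ w s, 0 ≤ P w s := fun w s =>
    mul_nonneg (Real.rpow_nonneg (expKernel_nonneg K _) _)
      (Real.rpow_nonneg (expKernel_nonneg K _) _)
  have hlt : ∀ s ∈ Icc (nextNode x j) (x j + 1), P x s < P x' s := by
    intro s hs
    have h1 := hx'.lt_nextNode j
    have h2 : x' j = x j + h / ν j := shrinkArc_self ν x j h hn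
    have h3 : nextNode x' j = nextNode x j - h / ν k := nextNode_shrinkArc ν x j h
    -- The interval for `s` is the complementary arc, so both distances `s - nextNode x j` and `s -
    -- x j` lie in `[0,1]`, where concavity applies.
    have key := expKernel_rpow_mul_lt hconc (hν k) (hν j) hh
      (by linarith [hs.1] : 0 ≤ s - nextNode x j) (by linarith [hs.2] : s - x j ≤ 1)
      (by linarith)
    have h4 : s - nextNode x j + h / ν k = s - nextNode x' j := by rw [h3]; ring
    have h5 : s - x j - h / ν j = s - x' j := by rw [h2]; ring
    rwa [h4, h5, expKernel_sub_nextNode, expKernel_sub_nextNode] at key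
  have hne : (Icc (nextNode x j) (x j + 1)).Nonempty :=
    nonempty_Icc.2 (hx.isLift.nextNode_le_add_one j j)
  have hpos : ∀ s ∈ Icc (nextNode x j) (x j + 1), 0 < P x' s := fun s hs =>
    (hP0 x s).trans_lt (hlt s hs)
  -- The factors that do not move, `J` among them, cancel in the ratio. What is left is continuous
  -- and below `1` on a compact interval, so its maximum serves as a uniform `ρ`; a pointwise
  -- inequality would not survive a supremum that is not attained.
  obtain ⟨s₀, hs₀, hmax⟩ := isCompact_Icc.exists_isMaxOn hne
    ((hPc x).continuousOn.div (hPc x').continuousOn fun s hs => (hpos s hs).ne')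
  refine ⟨P x s₀ / P x' s₀, div_nonneg (hP0 _ _) (hP0 _ _),
    (div_lt_one (hpos s₀ hs₀)).2 (hlt s₀ hs₀), fun s hs => ?_⟩
  have hle : P x s ≤ P x s₀ / P x' s₀ * P x' s := (div_le_iff₀ (hpos s hs)).1 (hmax hs)
  have hsplit : ∀ w : Fin n → ℝ, expSum ν K J w s = P w s * ((EReal.exp (J s)).toReal *
      ∏ i ∈ (Finset.univ.erase j).erase k, expKernel K (s - w i) ^ ν i) := by
    intro w
    rw [expSum, ← Finset.mul_prod_erase _ _ (Finset.mem_univ j),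
      ← Finset.mul_prod_erase (Finset.univ.erase j) _ (Finset.mem_erase.2 ⟨hkj, Finset.mem_univ k⟩)]
    ring
  have hrest : ∏ i ∈ (Finset.univ.erase j).erase k, expKernel K (s - x i) ^ ν i =
      ∏ i ∈ (Finset.univ.erase j).erase k, expKernel K (s - x' i) ^ ν i := by
    refine Finset.prod_congr rfl fun i hi => ?_
    simp only [Finset.mem_erase] at hi
    rw [hx'def, shrinkArc_of_ne ν x j h hi.2.1 hi.1]
  rw [hsplit, hsplit, hrest, ← mul_assoc (P x s₀ / P x' s₀)]
  exact mul_le_mul_of_nonneg_right hle (mul_nonneg ENNReal.toReal_nonneg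
    (Finset.prod_nonneg fun i _ => Real.rpow_nonneg (expKernel_nonneg K _) _))

/-- Shrinking one arc strictly increases the maxima over the other arcs. -/
lemma expArcMax_lt_expArcMax_shrinkArc {n : ℕ} (hn : 1 < n) {ν : Fin n → ℝ}
    (hν : ∀ j, 0 < ν j) {K : ℝ → ℝ} (hcont : Continuous (expKernel K))
    (hconc : StrictConcaveOn ℝ (Ioo 0 1) K) {J : UnitAddCircle → EReal} (hJ : IsField n J)
    {x : Fin n → ℝ} (hx : IsStrictLift x) {j : Fin n} {h : ℝ} (hh : 0 < h)
    (hx' : IsStrictLift (shrinkArc ν x j h)) {i : Fin n} (hi : i ≠ j)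
    (hpos : 0 < expArcMax ν K J x i) :
    expArcMax ν K J x i < expArcMax ν K J (shrinkArc ν x j h) i := by
  obtain ⟨ρ, hρ0, hρ1, hρ⟩ :=
    exists_expSum_le_mul_expSum_shrinkArc hn hν hcont hconc J hx hh hx'
  have hle : expArcMax ν K J x i ≤
      ENNReal.ofReal ρ * expArcMax ν K J (shrinkArc ν x j h) i := by
    refine iSup₂_le fun s hs => ?_
    have hs' : s ∈ Icc (shrinkArc ν x j h i) (nextNode (shrinkArc ν x j h) i) :=
      ⟨(shrinkArc_le ν x j h hν hh.le hi).trans hs.1,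
        hs.2.trans (le_nextNode_shrinkArc ν x j h hn hν hh.le hi)⟩
    have h1 : expSum ν K J x s ≤ ρ * expSum ν K J (shrinkArc ν x j h) s := by
      -- Arcs with `i < j` lie before `x j` and must be shifted by one turn to reach the
      -- complementary interval.
      rcases lt_or_gt_of_ne hi with hij | hij
      · have := hρ (s + 1) ⟨?_, ?_⟩
        · rwa [expSum_add_one, expSum_add_one] at this
        · linarith [hx.isLift.nextNode_le_add_one j i, hs.1]
        · linarith [hx.isLift.nextNode_le_of_lt hij, hs.2]
      · exact hρ s ⟨(hx.isLift.nextNode_le_of_lt hij).trans hs.1,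
          hs.2.trans (hx.isLift.nextNode_le_add_one i j)⟩
    calc ENNReal.ofReal (expSum ν K J x s)
        ≤ ENNReal.ofReal (ρ * expSum ν K J (shrinkArc ν x j h) s) := ENNReal.ofReal_le_ofReal h1
      _ = ENNReal.ofReal ρ * ENNReal.ofReal (expSum ν K J (shrinkArc ν x j h) s) :=
          ENNReal.ofReal_mul hρ0
      _ ≤ _ := by
          gcongr
          exact ofReal_expSum_le_expArcMax ν K J hs'
  by_contra! hcon
  have hfin := expArcMax_ne_top hν hcont hJ x i
  -- Strictness requires the supremum to be neither `0` nor `⊤`.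
  have h2 : ENNReal.ofReal ρ * expArcMax ν K J x i < 1 * expArcMax ν K J x i :=
    ENNReal.mul_lt_mul_left hpos.ne' hfin (ENNReal.ofReal_lt_one.2 hρ1)
  rw [one_mul] at h2
  exact absurd (hle.trans (by gcongr)) h2.not_ge

/-! ### Equioscillation of maximizers -/

/-- Nodes maximizing the minimal arc maximum equioscillate. -/
lemma expArcMax_eq_iInf {n : ℕ} {ν : Fin n → ℝ} (hν : ∀ j, 0 < ν j) {K : ℝ → ℝ}
    (hcont : Continuous (expKernel K)) (hconc : StrictConcaveOn ℝ (Ioo 0 1) K)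
    {J : UnitAddCircle → EReal} (hJ : IsField n J) {x : Fin n → ℝ} (hx : IsStrictLift x)
    (hmax : ∀ x', IsStrictLift x' → ⨅ i, expArcMax ν K J x' i ≤ ⨅ i, expArcMax ν K J x i)
    (hpos : ∀ j, 0 < expArcMax ν K J x j) (j : Fin n) :
    expArcMax ν K J x j = ⨅ i, expArcMax ν K J x i := by
  refine le_antisymm ?_ (iInf_le _ j)
  by_contra! hlt
  have hn : 1 < n := by
    by_contra! hn
    refine hlt.not_ge (le_iInf fun i => ?_)
    rw [show i = j from Fin.ext (by omega)]
  -- The supremum need not be attained, but a point above the minimum suffices. It is interior to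
  -- the arc because `expSum` vanishes at both ends.
  obtain ⟨s, hs, hsμ⟩ : ∃ s ∈ Icc (x j) (nextNode x j),
      ⨅ i, expArcMax ν K J x i < ENNReal.ofReal (expSum ν K J x s) := by
    simpa only [expArcMax, lt_iSup_iff, exists_prop] using hlt
  have hs0 : expSum ν K J x s ≠ 0 := fun h0 => by simp [h0] at hsμ
  have hs1 : x j < s := hs.1.lt_of_ne fun h0 => hs0 (h0 ▸ expSum_eq_zero hν K J x j)
  have hs2 : s < nextNode x j := hs.2.lt_of_ne fun h0 => hs0 (h0 ▸ expSum_nextNode hν K J x j)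
  have hc := continuous_shrinkArc ν x j
  have e1 : ∀ᶠ h in 𝓝 0, shrinkArc ν x j h j < s :=
    ((continuous_apply j).comp hc).continuousAt.eventually_lt continuousAt_const
      (by simpa [shrinkArc_zero] using hs1)
  have e2 : ∀ᶠ h in 𝓝 0, s < nextNode (shrinkArc ν x j h) j :=
    continuousAt_const.eventually_lt ((continuous_nextNode j).comp hc).continuousAt
      (by simpa [shrinkArc_zero] using hs2)
  -- Only the nodes move; `s`, and with it `J s`, stays fixed.
  have hcs : Continuous fun h => ENNReal.ofReal (expSum ν K J (shrinkArc ν x j h) s) := by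
    refine ENNReal.continuous_ofReal.comp (continuous_const.mul ?_)
    refine continuous_finsetProd _ fun i _ => ?_
    exact (hcont.comp (continuous_const.sub ((continuous_apply i).comp hc))).rpow_const
      fun _ => Or.inr (hν i).le
  have e3 : ∀ᶠ h in 𝓝 0, ⨅ i, expArcMax ν K J x i <
      ENNReal.ofReal (expSum ν K J (shrinkArc ν x j h) s) :=
    continuousAt_const.eventually_lt hcs.continuousAt (by simpa only [shrinkArc_zero] using hsμ)
  have e4 := eventually_isStrictLift_shrinkArc ν hx j
  obtain ⟨h, ⟨⟨⟨⟨h1, h2⟩, h3⟩, h4⟩, hh⟩⟩ :=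
    ((((e1.and e2).and e3).and e4).filter_mono nhdsWithin_le_nhds).and
      (self_mem_nhdsWithin (a := (0 : ℝ)) (s := Ioi 0)) |>.exists
  have : Nonempty (Fin n) := ⟨j⟩
  obtain ⟨i, hi⟩ := exists_eq_ciInf_of_finite (f := fun i => expArcMax ν K J (shrinkArc ν x j h) i)
  have hm := hmax _ h4
  rw [← hi] at hm
  refine hm.not_gt ?_
  by_cases hij : i = j
  · rw [hij]
    exact h3.trans_le (ofReal_expSum_le_expArcMax ν K J ⟨h1.le, h2.le⟩)
  · exact (iInf_le _ i).trans_lt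
      (expArcMax_lt_expArcMax_shrinkArc hn hν hcont hconc hJ hx hh h4 hij (hpos i))

/-! ### Existence of a maximizer -/

/-- The minimal arc maximum attains its supremum over strictly ordered nodes. -/
lemma exists_isMax_iInf_expArcMax {n : ℕ} (hn : 0 < n) {ν : Fin n → ℝ} (hν : ∀ j, 0 < ν j)
    {K : ℝ → ℝ} (hcont : Continuous (expKernel K)) {J : UnitAddCircle → EReal} (hJ : IsField n J) :
    ∃ x : Fin n → ℝ, IsStrictLift x ∧ 0 < ⨅ i, expArcMax ν K J x i ∧
      ∀ x', IsStrictLift x' → (∀ j, 0 ≤ x' j) → (∀ j, nextNode x' j ≤ 2) →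
        ⨅ i, expArcMax ν K J x' i ≤ ⨅ i, expArcMax ν K J x i := by
  have : Nonempty (Fin n) := ⟨⟨0, hn⟩⟩
  -- An integer shift brings `x 0` into `[0,1)`, and then every arc ends by `x 0 + 1 < 2`; so the
  -- bounds `0` and `2` lose no configuration and make `X` compact.
  set X : Set (Fin n → ℝ) := {x | IsLift x ∧ (∀ j, 0 ≤ x j) ∧ ∀ j, nextNode x j ≤ 2} with hX
  have hclosed : IsClosed X := by
    have h1 : IsClosed {x : Fin n → ℝ | Monotone x} := by
      simp only [Monotone, ofPred_forall]
      exact isClosed_iInter fun i => isClosed_iInter fun k => isClosed_iInter fun _ =>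
        isClosed_le (continuous_apply i) (continuous_apply k)
    have h2 : IsClosed {x : Fin n → ℝ | ∀ i j, x j ≤ x i + 1} := by
      simp only [ofPred_forall]
      exact isClosed_iInter fun i => isClosed_iInter fun k =>
        isClosed_le (continuous_apply k) ((continuous_apply i).add continuous_const)
    have h3 : IsClosed {x : Fin n → ℝ | ∀ j, 0 ≤ x j} := by
      simp only [ofPred_forall]
      exact isClosed_iInter fun i => isClosed_le continuous_const (continuous_apply i)
    have h4 : IsClosed {x : Fin n → ℝ | ∀ j, nextNode x j ≤ 2} := by
      simp only [ofPred_forall]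
      exact isClosed_iInter fun i => isClosed_le (continuous_nextNode i) continuous_const
    exact (h1.inter h2).inter (h3.inter h4)
  have hcompact : IsCompact X := by
    refine (isCompact_Icc (a := (0 : Fin n → ℝ)) (b := fun _ => 2)).of_isClosed_subset hclosed ?_
    exact fun x hx => ⟨hx.2.1, fun j => (hx.1.le_nextNode j).trans (hx.2.2 j)⟩
  obtain ⟨w, hw, hw01, hwpos⟩ := exists_isStrictLift_expArcMax_pos ν K hJ
  have hwX : w ∈ X := by
    refine ⟨hw.isLift, fun j => (hw01 j).1, fun j => ?_⟩
    linarith [hw.isLift.nextNode_le_add_one j j, (hw01 j).2]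
  have husc : UpperSemicontinuousOn (fun x => ⨅ j, expArcMax ν K J x j) X :=
    upperSemicontinuousOn_iInf fun j =>
      (upperSemicontinuousOn_expArcMax hν hcont hJ j (a := 0) (b := 2)).mono
        fun x hx => ⟨hx.1, hx.2.1 j, hx.2.2 j⟩
  obtain ⟨x, hxX, hmax⟩ := husc.exists_isMaxOn ⟨w, hwX⟩ hcompact
  have hpos : 0 < ⨅ i, expArcMax ν K J x i := by
    refine lt_of_lt_of_le ?_ (hmax hwX)
    obtain ⟨i, hi⟩ := exists_eq_ciInf_of_finite (f := fun i => expArcMax ν K J w i)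
    simp only [← hi]
    exact hwpos i
  refine ⟨x, isStrictLift_of_lt_nextNode fun j => ?_, hpos, fun x' hx' h0 h2 =>
    hmax (show x' ∈ X from ⟨hx'.isLift, h0, h2⟩)⟩
  -- A degenerate arc consists of a single node, where `expSum` is zero, against positivity of the
  -- minimum.
  refine (hxX.1.le_nextNode j).lt_of_ne fun heq => ?_
  refine (hpos.trans_le (iInf_le _ j)).ne' (le_bot_iff.1 (iSup₂_le fun s hs => ?_))
  rw [← heq] at hs
  rw [le_antisymm hs.2 hs.1, expSum_eq_zero hν, ENNReal.ofReal_zero]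
  exact bot_le

lemma exists_isStrictLift_of_mem_openSimplex {n : ℕ} {y : Fin n → UnitAddCircle}
    (hy : y ∈ openSimplex n) :
    ∃ x : Fin n → ℝ, IsStrictLift x ∧ (∀ j, 0 ≤ x j) ∧ (∀ j, nextNode x j ≤ 2) ∧
      y = fun j => (x j : UnitAddCircle) := by
  obtain ⟨x, hx1, hx2, hxy⟩ := hy
  cases n with
  | zero => exact ⟨x, ⟨hx1, hx2⟩, fun j => j.elim0, fun j => j.elim0, funext hxy⟩
  | succ m =>
    have hx' : IsStrictLift fun i => x i - ⌊x 0⌋ :=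
      ⟨fun i j hij => sub_lt_sub_right (hx1 hij) _, fun i j => by linarith [hx2 i j]⟩
    have h0 : ∀ i, 0 ≤ x i - ⌊x 0⌋ := fun i => by
      linarith [Int.floor_le (x 0), hx1.monotone (Fin.zero_le i)]
    refine ⟨fun i => x i - ⌊x 0⌋, hx', h0, fun j => ?_, funext fun j => ?_⟩
    · linarith [hx'.isLift.nextNode_le_add_one j 0, Int.lt_floor_add_one (x 0)]
    · rw [hxy, eq_comm, ← sub_eq_zero, ← AddCircle.coe_sub, AddCircle.coe_eq_zero_iff]
      exact ⟨-⌊x 0⌋, by rw [zsmul_one]; push_cast; ring⟩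

lemma exists_isLift_of_mem_closedSimplex {n : ℕ} {y : Fin n → UnitAddCircle}
    (hy : y ∈ closedSimplex n) :
    ∃ x : Fin n → ℝ, IsLift x ∧ y = fun j => (x j : UnitAddCircle) := by
  obtain ⟨x, hx1, hx2, hxy⟩ := hy
  exact ⟨x, ⟨hx1, hx2⟩, funext hxy⟩

lemma IsLift.mem_closedSimplex {n : ℕ} {x : Fin n → ℝ} (hx : IsLift x) :
    (fun j => (x j : UnitAddCircle)) ∈ closedSimplex n :=
  ⟨x, hx.1, hx.2, fun _ => rfl⟩

lemma IsStrictLift.mem_openSimplex {n : ℕ} {x : Fin n → ℝ} (hx : IsStrictLift x) :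
    (fun j => (x j : UnitAddCircle)) ∈ openSimplex n :=
  ⟨x, hx.1, hx.2, fun _ => rfl⟩

/-- The minimal arc maximum attains its supremum, at a point where it is finite. -/
lemma exists_isMax_minArcMax {n : ℕ} (hn : 0 < n) {ν : Fin n → ℝ} (hν : ∀ j, 0 < ν j)
    {K : ℝ → ℝ} (hK : IsKernel K) (hsing : IsSingular K) (hper : IsPeriodic K)
    {J : UnitAddCircle → EReal} (hJ : IsField n J) :
    ∃ z ∈ closedSimplex n, minArcMax ν K J z ≠ ⊥ ∧
      ∀ y ∈ closedSimplex n, minArcMax ν K J y ≤ minArcMax ν K J z := by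
  obtain ⟨x, hx, hpos, hmax⟩ :=
    exists_isMax_iInf_expArcMax hn hν (continuous_expKernel hK hsing hper) hJ
  refine ⟨_, hx.isLift.mem_closedSimplex, ?_, fun y hy => ?_⟩
  · rw [Ne, ← EReal.exp_eq_zero_iff, exp_minArcMax hν hsing hJ hx]
    exact hpos.ne'
  obtain ⟨w, hw, rfl⟩ := exists_isLift_of_mem_closedSimplex hy
  by_cases hw' : IsStrictLift w
  · obtain ⟨v, hv, hv0, hv2, he⟩ := exists_isStrictLift_of_mem_openSimplex hw'.mem_openSimplex
    rw [he, ← EReal.exp_le_exp_iff, exp_minArcMax hν hsing hJ hx, exp_minArcMax hν hsing hJ hv]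
    exact hmax v hv hv0 hv2
  · rw [minArcMax_eq_bot hν hsing hJ hw hw']
    exact bot_le

end SumOfTranslates

end

/-! ### The theorem on the circle -/

theorem mainTheorem3 (n : ℕ) (hn : 0 < n) (ν : Fin n → ℝ) (hν : ∀ j, 0 < ν j)
    (K : ℝ → ℝ) (hK : SumOfTranslates.IsKernel K) (hsing : SumOfTranslates.IsSingular K)
    (hconc : SumOfTranslates.IsStrictlyConcave K) (hper : SumOfTranslates.IsPeriodic K)
    (J : UnitAddCircle → EReal) (hJ : SumOfTranslates.IsField n J) :
    (∃ z, SumOfTranslates.IsMaximinPoint ν K J z) ∧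
      ∀ z, SumOfTranslates.IsMaximinPoint ν K J z →
        z ∈ SumOfTranslates.openSimplex n ∧ SumOfTranslates.Equioscillates ν K J z := by
  open SumOfTranslates in
  obtain ⟨z₀, hz₀, hbot, hmax⟩ := exists_isMax_minArcMax hn hν hK hsing hper hJ
  refine ⟨⟨z₀, hz₀, le_antisymm (le_iSup₂ (f := fun y _ => minArcMax ν K J y) z₀ hz₀)
    (iSup₂_le hmax)⟩, ?_⟩
  rintro z ⟨hz, hzmax⟩
  have hzmax' : ∀ y ∈ closedSimplex n, minArcMax ν K J y ≤ minArcMax ν K J z := fun y hy =>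
    hzmax ▸ le_iSup₂ (f := fun y (_ : y ∈ closedSimplex n) => minArcMax ν K J y) y hy
  have hzbot : minArcMax ν K J z ≠ ⊥ := fun h => hbot (le_bot_iff.1 (h ▸ hzmax' z₀ hz₀))
  obtain ⟨x, hxl, rfl⟩ := exists_isLift_of_mem_closedSimplex hz
  have hx : IsStrictLift x := by
    by_contra hx
    exact hzbot (minArcMax_eq_bot hν hsing hJ hxl hx)
  have hpos : 0 < ⨅ i, expArcMax ν K J x i := by
    rw [← exp_minArcMax hν hsing hJ hx, pos_iff_ne_zero, Ne, EReal.exp_eq_zero_iff]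
    exact hzbot
  have heq := expArcMax_eq_iInf hν (continuous_expKernel hK hsing hper) hconc.2 hJ hx
    (fun x' hx' => by
      rw [← exp_minArcMax hν hsing hJ hx, ← exp_minArcMax hν hsing hJ hx', EReal.exp_le_exp_iff]
      exact hzmax' _ hx'.isLift.mem_closedSimplex)
    (fun j => hpos.trans_le (iInf_le _ j))
  refine ⟨hx.mem_openSimplex, fun i j => EReal.exp_strictMono.injective ?_⟩
  rw [exp_arcMax hν hsing hJ hx, exp_arcMax hν hsing hJ hx, heq i, heq j]
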